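/- Let $\mathcal H$ be a complex Hilbert space (inner products are conjugate linear in the first variable), write $|x\rangle\langle y|$ for the operator $v\mapsto\langle y,v\rangle x$, and let $(T_t)_{t\ge 0}$ be a quantum Markov semigroup on $\mathcal B(\mathcal H)$: each $T_t:\mathcal B(\mathcal H)\to\mathcal B(\mathcal H)$ is linear, completely positive and $\sigma$-weakly continuous, $T_0=\mathrm{id}$, $T_{t+s}=T_tT_s$, $T_t(1)=1$, and $t\mapsto T_t(A)$ is $\sigma$-weakly continuous for every $A$. Let $L$ be its generator: $D(L)$ is the set of all $A$ for which $\frac1t(T_t(A)-A)$ converges $\sigma$-weakly as $t\to0^+$, and $L(A)$ is the limit. Let $\mathcal A=\{A\in D(L): A^*A\in D(L),\ AA^*\in D(L)\}$ be the domain algebra of $L$, which is the largest $*$-subalgebra of $\mathcal B(\mathcal H)$ contained in $D(L)$. Let $T\in D(L)$ be a non-zero positive operator of finite rank and let $h$ be an associate vector of $T$: there are orthonormal vectors $k_1',\dots,k_m'$ and numbers $t_1',\dots,t_m'>0$ with $T=\sum_s t_s'|k_s'\rangle\langle k_s'|$ and $h=\sum_s\|k_s\|^{-2}k_s$, where $k_s=\sqrt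 t\,k_s'$ and $t=\sum_s t_s'$. Suppose that $|Th\rangle\langle Th|\in D(L)$. Let $U=\{x\in\mathcal H: |x\rangle\langle Th|\in\mathcal A\}$, a linear subspace that is invariant under $\mathcal A$, and define the linear operator $G:U\to\mathcal H$ by $$Gx=L(|x\rangle\langle Th|)h-\tfrac12\langle h,L(T)h\rangle x .$$ Suppose that there is $C>0$ with $\|L(|x\rangle\langle Th|)h\|\le C\|x\|$ for all $x\in U$. Then: 1. $G$ is bounded on $U$, i.e. there is a constant $C'$ with $\|Gx\|\le C'\|x\|$ for all $x\in U$. 2. Let $\phi$ be a $U$-completely positive map from $\mathcal A$ to the sesquilinear forms on $U\times U$, that is, $\phi$ is linear and $\sum_{i,j=1}^k\phi(A_{ij})(u_i,u_j)\ge0$ for all $k$, all positive operators $(A_{ij})\in\mathcal A\otimes M_k(\mathbb C)$ and all $u_1,\dots,u_k\in U$. Suppose that $$\langle u,L(A)v\rangle=\phi(A)(u,v)+\langle u,GAv\rangle+\langle GA^*u,v\rangle\qquad(A\in\mathcal A,\ u,v\in U).$$ Let $\mathcal K$ be the Hilbert space obtained by completing $(\mathcal A\otimes U)/N$, where $\mathcal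 A\otimes U$ carries the semi-inner product determined by $(A\otimes u,B\otimes v)=\phi(A^*B)(u,v)$ and $N$ is its subspace of null vectors, and let $V:U\to\mathcal K$, $Vx=1\otimes x+N$. Then $V$ is bounded on $U$, i.e. there is a constant $C''$ with $\|Vx\|\le C''\|x\|$ for all $x\in U$. -/

import Mathlib

open scoped ComplexOrder InnerProductSpace TensorProduct NNReal Topology ComplexConjugate
open Filter

namespace QMS

/-! ### The sigma-weak topology on the bounded operators of a Hilbert space -/

section SigmaWeak

variable {H : Type*} [NormedAddCommGroup H] [InnerProductSpace ℂ H]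

/-- The functional `A ↦ ∑ₙ ⟪xₙ, A yₙ⟫`, i.e. the trace pairing of `A` with the trace class
operator `∑ₙ |yₙ⟩⟨xₙ|` (for square summable sequences `x`, `y`). -/
noncomputable def traceFunctional (x y : ℕ → H) (A : H →L[ℂ] H) : ℂ :=
  ∑' n, ⟪x n, A (y n)⟫_ℂ

/-- Pairs of square summable sequences of vectors; they index the normal functionals. -/
abbrev SqSummablePair (H : Type*) [NormedAddCommGroup H] : Type _ :=
  {p : (ℕ → H) × (ℕ → H) //
    Summable (fun n => ‖p.1 n‖ ^ 2) ∧ Summable (fun n => ‖p.2 n‖ ^ 2)}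

/-- The sigma-weak topology on `B(H)`: the coarsest topology that makes all functionals
`A ↦ ∑ₙ ⟪xₙ, A yₙ⟫` with `∑ₙ ‖xₙ‖² < ∞` and `∑ₙ ‖yₙ‖² < ∞` continuous, that is, the weak-star
topology given by the trace class operators. -/
@[reducible] noncomputable def sigmaWeak (H : Type*) [NormedAddCommGroup H] [InnerProductSpace ℂ H] :
    TopologicalSpace (H →L[ℂ] H) :=
  ⨅ p : SqSummablePair H,
    TopologicalSpace.induced (traceFunctional p.1.1 p.1.2) inferInstance

theorem tendsto_sigmaWeak {ι : Type*} {l : Filter ι} {f : ι → (H →L[ℂ] H)} {B : H →L[ℂ] H} :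
    Tendsto f l (@nhds _ (sigmaWeak H) B) ↔
      ∀ p : SqSummablePair H, Tendsto (fun i => traceFunctional p.1.1 p.1.2 (f i)) l
        (𝓝 (traceFunctional p.1.1 p.1.2 B)) := by
  simp only [nhds_iInf, tendsto_iInf, nhds_induced, tendsto_comap_iff]
  rfl

theorem summable_pair (p : SqSummablePair H) : Summable fun n => ‖p.1.1 n‖ * ‖p.1.2 n‖ := by
  refine Summable.of_nonneg_of_le (fun n => by positivity) (fun n => ?_) (p.2.1.add p.2.2)
  nlinarith [sq_nonneg (‖p.1.1 n‖ - ‖p.1.2 n‖), sq_nonneg (‖p.1.1 n‖), sq_nonneg (‖p.1.2 n‖)]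

theorem norm_term_le (p : SqSummablePair H) (A : H →L[ℂ] H) (n : ℕ) :
    ‖⟪p.1.1 n, A (p.1.2 n)⟫_ℂ‖ ≤ ‖A‖ * (‖p.1.1 n‖ * ‖p.1.2 n‖) := by
  calc ‖⟪p.1.1 n, A (p.1.2 n)⟫_ℂ‖ ≤ ‖p.1.1 n‖ * ‖A (p.1.2 n)‖ := norm_inner_le_norm _ _
    _ ≤ ‖p.1.1 n‖ * (‖A‖ * ‖p.1.2 n‖) := by gcongr; exact A.le_opNorm _
    _ = _ := by ring

theorem summable_term (p : SqSummablePair H) (A : H →L[ℂ] H) :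
    Summable fun n => ⟪p.1.1 n, A (p.1.2 n)⟫_ℂ :=
  Summable.of_norm_bounded ((summable_pair p).mul_left ‖A‖) (norm_term_le p A)

theorem traceFunctional_add (p : SqSummablePair H) (A B : H →L[ℂ] H) :
    traceFunctional p.1.1 p.1.2 (A + B) =
      traceFunctional p.1.1 p.1.2 A + traceFunctional p.1.1 p.1.2 B := by
  simp only [traceFunctional, add_apply, inner_add_right]
  exact (summable_term p A).tsum_add (summable_term p B)

theorem traceFunctional_smul (p : SqSummablePair H) (c : ℂ) (A : H →L[ℂ] H) :
    traceFunctional p.1.1 p.1.2 (c • A) = c * traceFunctional p.1.1 p.1.2 A := by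
  simp only [traceFunctional, smul_apply, inner_smul_right]
  exact tsum_mul_left

theorem traceFunctional_sub (p : SqSummablePair H) (A B : H →L[ℂ] H) :
    traceFunctional p.1.1 p.1.2 (A - B) =
      traceFunctional p.1.1 p.1.2 A - traceFunctional p.1.1 p.1.2 B := by
  have h := traceFunctional_add p A ((-1 : ℂ) • B)
  rw [traceFunctional_smul] at h
  rw [sub_eq_add_neg, ← neg_one_smul ℂ B, h]
  ring

/-- The pair of sequences whose functional is the vector functional `A ↦ ⟪x, A y⟫`. -/
noncomputable def vectorPair (x y : H) : SqSummablePair H :=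
  ⟨(Pi.single 0 x, Pi.single 0 y), by
    constructor <;>
    · refine summable_of_ne_finset_zero (s := {0}) fun n hn => ?_
      simp only [Finset.mem_singleton] at hn
      simp [hn]⟩

theorem traceFunctional_vectorPair (x y : H) (A : H →L[ℂ] H) :
    traceFunctional (vectorPair x y).1.1 (vectorPair x y).1.2 A = ⟪x, A y⟫_ℂ := by
  rw [traceFunctional, tsum_eq_single 0]
  · simp [vectorPair]
  · intro n hn
    simp [vectorPair, hn]

theorem sigmaWeak_unique {ι : Type*} {l : Filter ι} [l.NeBot] {f : ι → (H →L[ℂ] H)}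
    {B C : H →L[ℂ] H} (hB : Tendsto f l (@nhds _ (sigmaWeak H) B))
    (hC : Tendsto f l (@nhds _ (sigmaWeak H) C)) : B = C := by
  ext y
  refine ext_inner_left ℂ fun x => ?_
  rw [← traceFunctional_vectorPair x y B, ← traceFunctional_vectorPair x y C]
  exact tendsto_nhds_unique (tendsto_sigmaWeak.1 hB _) (tendsto_sigmaWeak.1 hC _)

/-- On bounded families, convergence against vector functionals is sigma-weak convergence. -/
theorem tendsto_sigmaWeak_of_bounded {ι : Type*} {l : Filter ι} {f : ι → (H →L[ℂ] H)}
    {B : H →L[ℂ] H} {C : ℝ} (hb : ∀ᶠ i in l, ‖f i‖ ≤ C)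
    (hf : ∀ x y, Tendsto (fun i => ⟪x, f i y⟫_ℂ) l (𝓝 ⟪x, B y⟫_ℂ)) :
    Tendsto f l (@nhds _ (sigmaWeak H) B) := by
  refine tendsto_sigmaWeak.2 fun p => ?_
  refine tendsto_tsum_of_dominated_convergence (bound := fun n => C * (‖p.1.1 n‖ * ‖p.1.2 n‖))
    ((summable_pair p).mul_left C) (fun n => hf _ _) ?_
  filter_upwards [hb] with i hi n
  exact (norm_term_le p (f i) n).trans (by gcongr)

theorem opNorm_le_of_inner {A : H →L[ℂ] H} {C : ℝ} (hC : 0 ≤ C)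
    (h : ∀ x y, ‖⟪x, A y⟫_ℂ‖ ≤ C * ‖x‖ * ‖y‖) : ‖A‖ ≤ C := by
  refine A.opNorm_le_bound hC fun y => ?_
  have h1 := h (A y) y
  rw [inner_self_eq_norm_sq_to_K] at h1
  simp only [Complex.coe_algebraMap, norm_pow, Complex.norm_real, norm_norm] at h1
  by_cases h0 : ‖A y‖ = 0
  · rw [h0]; positivity
  · have : 0 < ‖A y‖ := lt_of_le_of_ne (norm_nonneg _) (Ne.symm h0)
    nlinarith

end SigmaWeak

/-! ### Positive sesquilinear kernels -/

section Kernel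

variable {R U : Type*} [Ring R] [StarRing R] [Algebra ℂ R] [StarModule ℂ R]
  [AddCommGroup U] [Module ℂ U]

/-- The sesquilinear form on `R ⊗ U` given by `(A ⊗ u, B ⊗ v) = ψ(A* B)(u, v)`. -/
noncomputable def tensorForm (ψ : R →ₗ[ℂ] (U →ₗ⋆[ℂ] U →ₗ[ℂ] ℂ)) :
    (R ⊗[ℂ] U) →ₗ⋆[ℂ] (R ⊗[ℂ] U) →ₗ[ℂ] ℂ :=
  TensorProduct.lift (LinearMap.mk₂'ₛₗ (starRingEnd ℂ) (starRingEnd ℂ)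
    (fun A u => TensorProduct.lift (LinearMap.mk₂ ℂ (fun B v => ψ (star A * B) u v)
      (by intros; simp [mul_add]) (by intros; simp) (by intros; simp) (by intros; simp)))
    (by intros; ext; simp [add_mul]) (by intros; ext; simp)
    (by intros; ext; simp) (by intros; ext; simp))

@[simp] theorem tensorForm_tmul (ψ : R →ₗ[ℂ] (U →ₗ⋆[ℂ] U →ₗ[ℂ] ℂ)) (A B : R) (u v : U) :
    tensorForm ψ (A ⊗ₜ u) (B ⊗ₜ v) = ψ (star A * B) u v := by
  simp [tensorForm]

theorem tensorForm_sum (ψ : R →ₗ[ℂ] (U →ₗ⋆[ℂ] U →ₗ[ℂ] ℂ)) {n : ℕ} (A : Fin n → R)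
    (u : Fin n → U) :
    tensorForm ψ (∑ i, A i ⊗ₜ u i) (∑ i, A i ⊗ₜ u i) =
      ∑ i, ∑ j, ψ (star (A i) * A j) (u i) (u j) := by
  simp only [map_sum, LinearMap.sum_apply, tensorForm_tmul]
  exact Finset.sum_comm

theorem tensorForm_nonneg (ψ : R →ₗ[ℂ] (U →ₗ⋆[ℂ] U →ₗ[ℂ] ℂ))
    (h : ∀ (n : ℕ) (A : Fin n → R) (u : Fin n → U),
      0 ≤ ∑ i, ∑ j, ψ (star (A i) * A j) (u i) (u j)) (x : R ⊗[ℂ] U) :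
    0 ≤ tensorForm ψ x x := by
  obtain ⟨n, A, u, rfl⟩ := TensorProduct.exists_sum_tmul_eq x
  rw [tensorForm_sum]
  exact h n A u

/-- A positive sesquilinear form is Hermitian. -/
theorem conj_symm_of_nonneg {E : Type*} [AddCommGroup E] [Module ℂ E]
    (F : E →ₗ⋆[ℂ] E →ₗ[ℂ] ℂ) (h : ∀ x, 0 ≤ F x x) (x y : E) : conj (F y x) = F x y := by
  have i0 : ∀ z, (F z z).im = 0 := fun z => ((Complex.nonneg_iff.1 (h z)).2).symm
  have h1 := i0 (x + y)
  have h2 := i0 (x + Complex.I • y)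
  simp only [map_add, LinearMap.add_apply, LinearMap.map_smulₛₗ, LinearMap.smul_apply,
    smul_eq_mul, Complex.add_im, Complex.mul_im, Complex.mul_re, i0, Complex.conj_I,
    Complex.neg_im, Complex.neg_re, Complex.I_re, Complex.I_im, RingHom.id_apply,
    Complex.add_re] at h1 h2
  apply Complex.ext
  · simp only [Complex.conj_re]; linarith
  · simp only [Complex.conj_im]; linarith

theorem form_add_le {E : Type*} [AddCommGroup E] [Module ℂ E]
    (F : E →ₗ⋆[ℂ] E →ₗ[ℂ] ℂ) (h : ∀ x, 0 ≤ F x x) (x y : E) :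
    (F (x + y) (x + y)).re ≤ 2 * (F x x).re + 2 * (F y y).re := by
  have h1 := (Complex.nonneg_iff.1 (h (x - y))).1
  simp only [map_add, map_sub, LinearMap.add_apply, LinearMap.sub_apply, Complex.add_re,
    Complex.sub_re] at h1 ⊢
  linarith

end Kernel

/-! ### Completely positive maps and quantum Markov semigroups on `B(H)` -/

section Semigroup

variable {H : Type*} [NormedAddCommGroup H] [InnerProductSpace ℂ H]

/-- A `k × k` matrix of bounded operators on `H` is positive if it is a positive operator on the
Hilbert space `H ⊕ ⋯ ⊕ H` (`k` summands). -/
def IsPositiveMatrix {k : ℕ} (A : Matrix (Fin k) (Fin k) (H →L[ℂ] H)) : Prop :=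
  ∀ u : Fin k → H, 0 ≤ ∑ i, ∑ j, ⟪u i, A i j (u j)⟫_ℂ

/-- `Φ` is completely positive: all its amplifications to matrices are positive. -/
def IsCompletelyPositive (Φ : (H →L[ℂ] H) →ₗ[ℂ] (H →L[ℂ] H)) : Prop :=
  ∀ (k : ℕ) (A : Matrix (Fin k) (Fin k) (H →L[ℂ] H)),
    IsPositiveMatrix A → IsPositiveMatrix (A.map Φ)

/-- A quantum Markov semigroup on `B(H)`. -/
structure QuantumMarkovSemigroup (H : Type*) [NormedAddCommGroup H] [InnerProductSpace ℂ H] where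
  /-- The operator at time `t`. -/
  map : ℝ≥0 → ((H →L[ℂ] H) →ₗ[ℂ] (H →L[ℂ] H))
  sigmaWeak_continuous : ∀ t, Continuous[sigmaWeak H, sigmaWeak H] (map t)
  completelyPositive : ∀ t, IsCompletelyPositive (map t)
  map_zero : map 0 = LinearMap.id
  map_add : ∀ t s, map (t + s) = map t ∘ₗ map s
  orbit_continuous : ∀ A, Continuous[inferInstance, sigmaWeak H] (fun t => map t A)
  map_one : ∀ t, map t 1 = 1

namespace QuantumMarkovSemigroup

variable (S : QuantumMarkovSemigroup H)

/-- `S.HasDeriv A B` says that `t⁻¹ (T_t A - A)` converges sigma-weakly to `B` as `t → 0+`. -/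
def HasDeriv (A B : H →L[ℂ] H) : Prop :=
  Tendsto (fun t : ℝ≥0 => ((t : ℝ) : ℂ)⁻¹ • (S.map t A - A)) (𝓝[>] 0) (@nhds _ (sigmaWeak H) B)

variable {S}

theorem HasDeriv.add {A B A' B' : H →L[ℂ] H} (h : S.HasDeriv A B) (h' : S.HasDeriv A' B') :
    S.HasDeriv (A + A') (B + B') := by
  refine tendsto_sigmaWeak.2 fun p => ?_
  rw [traceFunctional_add]
  refine ((tendsto_sigmaWeak.1 h p).add (tendsto_sigmaWeak.1 h' p)).congr fun t => ?_
  rw [← traceFunctional_add, ← smul_add, _root_.map_add]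
  congr 2
  abel

theorem HasDeriv.smul {A B : H →L[ℂ] H} (c : ℂ) (h : S.HasDeriv A B) :
    S.HasDeriv (c • A) (c • B) := by
  refine tendsto_sigmaWeak.2 fun p => ?_
  rw [traceFunctional_smul]
  refine ((tendsto_sigmaWeak.1 h p).const_mul c).congr fun t => ?_
  rw [← traceFunctional_smul, smul_comm, _root_.map_smul, smul_sub]

theorem hasDeriv_one : S.HasDeriv 1 0 := by
  refine tendsto_sigmaWeak.2 fun p => ?_
  simp only [S.map_one, sub_self, smul_zero]
  exact tendsto_const_nhds

theorem hasDeriv_zero : S.HasDeriv 0 0 := by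
  simpa using (hasDeriv_one (S := S)).smul 0

theorem HasDeriv.unique {A B C : H →L[ℂ] H} (h : S.HasDeriv A B) (h' : S.HasDeriv A C) : B = C :=
  sigmaWeak_unique h h'

variable (S)

/-- The (unbounded) infinitesimal generator `L` of the semigroup: its domain `D(L)` consists of
all `A` for which `t⁻¹ (T_t A - A)` converges sigma-weakly as `t → 0+`, and `L A` is the limit. -/
noncomputable def generator : (H →L[ℂ] H) →ₗ.[ℂ] (H →L[ℂ] H) where
  domain :=
    { carrier := {A | ∃ B, S.HasDeriv A B}
      add_mem' := fun ⟨B, h⟩ ⟨B', h'⟩ => ⟨B + B', h.add h'⟩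
      zero_mem' := ⟨0, hasDeriv_zero⟩
      smul_mem' := fun c _ ⟨B, h⟩ => ⟨c • B, h.smul c⟩ }
  toFun :=
    { toFun := fun A => A.2.choose
      map_add' := fun A A' =>
        ((A + A').2.choose_spec).unique (A.2.choose_spec.add A'.2.choose_spec)
      map_smul' := fun c A => ((c • A).2.choose_spec).unique (A.2.choose_spec.smul c) }

theorem mem_domain {A : H →L[ℂ] H} : A ∈ S.generator.domain ↔ ∃ B, S.HasDeriv A B := Iff.rfl

theorem generator_hasDeriv (A : S.generator.domain) :
    S.HasDeriv (A : H →L[ℂ] H) (S.generator A) :=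
  A.2.choose_spec

end QuantumMarkovSemigroup

end Semigroup


/-! ### Estimates for completely positive maps -/

section CP

variable {H : Type*} [NormedAddCommGroup H] [InnerProductSpace ℂ H]

/-- The map `A ↦ ((u, v) ↦ ⟪u, Φ(A) v⟫)`. -/
noncomputable def opForm (Φ : (H →L[ℂ] H) →ₗ[ℂ] (H →L[ℂ] H)) :
    (H →L[ℂ] H) →ₗ[ℂ] (H →ₗ⋆[ℂ] H →ₗ[ℂ] ℂ) where
  toFun A := LinearMap.mk₂'ₛₗ (starRingEnd ℂ) (RingHom.id ℂ) (fun u v => ⟪u, Φ A v⟫_ℂ)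
    (by intros; simp) (by intros; simp [mul_comm]) (by intros; simp) (by intros; simp)
  map_add' A B := by ext u v; simp
  map_smul' c A := by ext u v; simp

@[simp] theorem opForm_apply (Φ : (H →L[ℂ] H) →ₗ[ℂ] (H →L[ℂ] H)) (A : H →L[ℂ] H) (u v : H) :
    opForm Φ A u v = ⟪u, Φ A v⟫_ℂ := rfl

theorem inner_self_ofReal (x : H) : ⟪x, x⟫_ℂ = ((‖x‖ ^ 2 : ℝ) : ℂ) := by
  rw [inner_self_eq_norm_sq_to_K]
  simp

variable [CompleteSpace H] {Φ : (H →L[ℂ] H) →ₗ[ℂ] (H →L[ℂ] H)}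

theorem isPositiveMatrix_gram {k : ℕ} (A : Fin k → (H →L[ℂ] H)) :
    IsPositiveMatrix (Matrix.of fun i j => star (A i) * A j) := by
  intro u
  have : ∑ i, ∑ j, ⟪u i, (Matrix.of fun i j => star (A i) * A j) i j (u j)⟫_ℂ =
      ⟪∑ i, A i (u i), ∑ j, A j (u j)⟫_ℂ := by
    simp only [sum_inner, inner_sum, Matrix.of_apply, ContinuousLinearMap.star_eq_adjoint,
      mul_apply_eq_comp, ContinuousLinearMap.adjoint_inner_right]
    exact Finset.sum_comm
  rw [this, inner_self_ofReal]
  exact Complex.zero_le_real.2 (sq_nonneg _)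

theorem IsCompletelyPositive.tensorForm_nonneg (h : IsCompletelyPositive Φ)
    (x : (H →L[ℂ] H) ⊗[ℂ] H) : 0 ≤ tensorForm (opForm Φ) x x := by
  refine QMS.tensorForm_nonneg (opForm Φ) (fun n A u => ?_) x
  have h1 := h n _ (isPositiveMatrix_gram A) u
  simp only [Matrix.map_apply, Matrix.of_apply] at h1
  simp only [opForm_apply]
  exact h1

theorem IsCompletelyPositive.map_star (h : IsCompletelyPositive Φ) (A : H →L[ℂ] H) :
    Φ (star A) = star (Φ A) := by
  ext v
  refine ext_inner_left ℂ fun u => ?_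
  have := conj_symm_of_nonneg _ h.tensorForm_nonneg (A ⊗ₜ u) (1 ⊗ₜ v)
  simp only [tensorForm_tmul, opForm_apply, star_one, one_mul, mul_one] at this
  rw [← this, inner_conj_symm, ContinuousLinearMap.star_eq_adjoint (Φ A),
    ContinuousLinearMap.adjoint_inner_right]

/-- Left multiplication on the tensor product. -/
noncomputable def lmul (A : H →L[ℂ] H) :
    ((H →L[ℂ] H) ⊗[ℂ] H) →ₗ[ℂ] ((H →L[ℂ] H) ⊗[ℂ] H) :=
  LinearMap.rTensor H (LinearMap.mulLeft ℂ A)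

@[simp] theorem lmul_tmul (A B : H →L[ℂ] H) (u : H) : lmul A (B ⊗ₜ u) = (A * B) ⊗ₜ u := rfl

theorem IsCompletelyPositive.lmul_le (h : IsCompletelyPositive Φ) (A : H →L[ℂ] H)
    (x : (H →L[ℂ] H) ⊗[ℂ] H) :
    (tensorForm (opForm Φ) (lmul A x) (lmul A x)).re ≤
      ‖A‖ ^ 2 * (tensorForm (opForm Φ) x x).re := by
  obtain ⟨n, B, u, rfl⟩ := TensorProduct.exists_sum_tmul_eq x
  have hpos : IsPositiveMatrix (Matrix.of fun i j =>
      ((‖A‖ ^ 2 : ℝ) : ℂ) • (star (B i) * B j) - star (A * B i) * (A * B j)) := by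
    intro w
    have : ∑ i, ∑ j, ⟪w i, (Matrix.of fun i j =>
        ((‖A‖ ^ 2 : ℝ) : ℂ) • (star (B i) * B j) - star (A * B i) * (A * B j)) i j (w j)⟫_ℂ =
        ((‖A‖ ^ 2 : ℝ) : ℂ) * ⟪∑ i, B i (w i), ∑ j, B j (w j)⟫_ℂ -
          ⟪A (∑ i, B i (w i)), A (∑ j, B j (w j))⟫_ℂ := by
      simp only [map_sum, sum_inner, inner_sum, Matrix.of_apply,
        sub_apply, smul_apply, inner_sub_right, inner_smul_right,
        ContinuousLinearMap.star_eq_adjoint, Finset.sum_sub_distrib, Finset.mul_sum,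
        mul_apply_eq_comp, ContinuousLinearMap.adjoint_inner_right]
      congr 1 <;> exact Finset.sum_comm
    rw [this, inner_self_ofReal, inner_self_ofReal]
    have h2 := A.le_opNorm (∑ i, B i (w i))
    have h3 : ‖A (∑ i, B i (w i))‖ ^ 2 ≤ ‖A‖ ^ 2 * ‖∑ i, B i (w i)‖ ^ 2 := by
      rw [← mul_pow]; gcongr
    rw [sub_nonneg, ← Complex.ofReal_mul]
    exact Complex.real_le_real.2 h3
  have h1 := h n _ hpos u
  simp only [map_sum, lmul_tmul]
  have h2 : ∑ i, ∑ j, ⟪u i, ((Matrix.of fun i j => ((‖A‖ ^ 2 : ℝ) : ℂ) • (star (B i) * B j) -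
      star (A * B i) * (A * B j)).map Φ) i j (u j)⟫_ℂ =
      ((‖A‖ ^ 2 : ℝ) : ℂ) * (∑ i, ∑ j, ⟪u i, Φ (star (B i) * B j) (u j)⟫_ℂ) -
       ∑ i, ∑ j, ⟪u i, Φ (star (A * B i) * (A * B j)) (u j)⟫_ℂ := by
    simp only [Matrix.map_apply, Matrix.of_apply, map_sub, map_smul, sub_apply, smul_apply,
      inner_sub_right, inner_smul_right, Finset.sum_sub_distrib, Finset.mul_sum]
  rw [h2] at h1
  have h3 := (Complex.nonneg_iff.1 h1).1
  rw [Complex.sub_re, Complex.re_ofReal_mul] at h3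
  have e1 := tensorForm_sum (opForm Φ) B u
  have e2 := tensorForm_sum (opForm Φ) (fun i => A * B i) u
  simp only [map_sum, opForm_apply] at e1 e2 ⊢
  rw [e1, e2]
  linarith

/-- The defect vector `A ⊗ u - 1 ⊗ Φ(A) u`. -/
noncomputable def defect (Φ : (H →L[ℂ] H) →ₗ[ℂ] (H →L[ℂ] H)) (A : H →L[ℂ] H) (u : H) :
    (H →L[ℂ] H) ⊗[ℂ] H :=
  A ⊗ₜ u - 1 ⊗ₜ (Φ A u)

theorem IsCompletelyPositive.form_defect (h : IsCompletelyPositive Φ) (h1 : Φ 1 = 1)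
    (A : H →L[ℂ] H) (u : H) :
    tensorForm (opForm Φ) (defect Φ A u) (defect Φ A u) =
      ⟪u, (Φ (star A * A) - star (Φ A) * Φ A) u⟫_ℂ := by
  simp only [defect, map_sub, LinearMap.sub_apply, tensorForm_tmul, opForm_apply, star_one,
    one_mul, mul_one, h1, h.map_star, sub_apply, inner_sub_right, mul_apply_eq_comp,
    one_apply_eq_self]
  simp only [ContinuousLinearMap.star_eq_adjoint, ContinuousLinearMap.adjoint_inner_right]
  ring

theorem form_one (h1 : Φ 1 = 1) (u : H) :
    tensorForm (opForm Φ) (1 ⊗ₜ u) (1 ⊗ₜ u) = ((‖u‖ ^ 2 : ℝ) : ℂ) := by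
  rw [tensorForm_tmul, opForm_apply, star_one, one_mul, h1, one_apply_eq_self, inner_self_ofReal]

theorem IsCompletelyPositive.contraction (h : IsCompletelyPositive Φ) (h1 : Φ 1 = 1)
    (A : H →L[ℂ] H) : ‖Φ A‖ ≤ ‖A‖ := by
  refine ContinuousLinearMap.opNorm_le_bound _ (norm_nonneg _) fun u => ?_
  have e1 := (Complex.nonneg_iff.1 (h.tensorForm_nonneg (defect Φ A u))).1
  have e2 := h.lmul_le A (1 ⊗ₜ u)
  rw [form_one h1, lmul_tmul, mul_one, tensorForm_tmul, opForm_apply, Complex.ofReal_re] at e2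
  rw [h.form_defect h1, sub_apply, inner_sub_right, Complex.sub_re, mul_apply_eq_comp,
    ContinuousLinearMap.star_eq_adjoint (Φ A), ContinuousLinearMap.adjoint_inner_right,
    inner_self_ofReal, Complex.ofReal_re] at e1
  refine (sq_le_sq₀ (norm_nonneg _) (by positivity)).1 ?_
  rw [mul_pow]
  linarith

/-- The defect vector of a product. -/
theorem defect_mul (A B : H →L[ℂ] H) (u : H) :
    defect Φ (A * B) u = lmul A (defect Φ B u) + (defect Φ A (Φ B u) +
      1 ⊗ₜ ((Φ A * Φ B - Φ (A * B)) u)) := by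
  simp only [defect, map_sub, lmul_tmul, mul_one, sub_apply, mul_apply_eq_comp,
    TensorProduct.tmul_sub]
  abel

theorem defect_add (A B : H →L[ℂ] H) (u : H) :
    defect Φ (A + B) u = defect Φ A u + defect Φ B u := by
  simp only [defect, map_add, add_apply, TensorProduct.tmul_add, TensorProduct.add_tmul]
  abel

end CP

/-! ### The domain of the generator as a Favard class -/

section Favard

variable {H : Type*} [NormedAddCommGroup H] [InnerProductSpace ℂ H] [CompleteSpace H]

namespace QuantumMarkovSemigroup

variable (S : QuantumMarkovSemigroup H)

theorem norm_map_le (t : ℝ≥0) (A : H →L[ℂ] H) : ‖S.map t A‖ ≤ ‖A‖ :=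
  (S.completelyPositive t).contraction (S.map_one t) A

theorem continuous_traceFunctional_map (p : SqSummablePair H) (A : H →L[ℂ] H) :
    Continuous fun t : ℝ => traceFunctional p.1.1 p.1.2 (S.map t.toNNReal A) := by
  refine Continuous.comp (g := fun t : ℝ≥0 => traceFunctional p.1.1 p.1.2 (S.map t A)) ?_
    continuous_real_toNNReal
  refine continuous_iff_continuousAt.2 fun t => ?_
  have h := (@continuous_iff_continuousAt _ _ _ (sigmaWeak H) _).1 (S.orbit_continuous A) t
  exact tendsto_sigmaWeak.1 h p

variable {S}

theorem tendsto_map {ι : Type*} {l : Filter ι} {f : ι → (H →L[ℂ] H)} {B : H →L[ℂ] H} (t : ℝ≥0)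
    (h : Tendsto f l (@nhds _ (sigmaWeak H) B)) :
    Tendsto (fun i => S.map t (f i)) l (@nhds _ (sigmaWeak H) (S.map t B)) := by
  have h1 := (@continuous_iff_continuousAt _ _ (sigmaWeak H) (sigmaWeak H) _).1
    (S.sigmaWeak_continuous t) B
  exact Tendsto.comp h1 h

theorem slope_eq (p : SqSummablePair H) (A : H →L[ℂ] H) (t s : ℝ≥0) :
    traceFunctional p.1.1 p.1.2 (S.map t (((s : ℝ) : ℂ)⁻¹ • (S.map s A - A))) =
      ((s : ℝ) : ℂ)⁻¹ * (traceFunctional p.1.1 p.1.2 (S.map (t + s) A) -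
        traceFunctional p.1.1 p.1.2 (S.map t A)) := by
  rw [_root_.map_smul, traceFunctional_smul, map_sub, traceFunctional_sub, S.map_add]
  rfl

theorem tendsto_sub_toNNReal (x : ℝ) :
    Tendsto (fun z : ℝ => (z - x).toNNReal) (𝓝[>] x) (𝓝[>] 0) := by
  refine tendsto_nhdsWithin_iff.2 ⟨?_, ?_⟩
  · have : Continuous fun z : ℝ => (z - x).toNNReal := by fun_prop
    refine (this.tendsto' x 0 (by simp)).mono_left nhdsWithin_le_nhds
  · filter_upwards [self_mem_nhdsWithin] with z hz
    simpa using hz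

theorem tendsto_add_coe (x : ℝ) :
    Tendsto (fun s : ℝ≥0 => x + (s : ℝ)) (𝓝[>] 0) (𝓝[>] x) := by
  refine tendsto_nhdsWithin_iff.2 ⟨?_, ?_⟩
  · have : Continuous fun s : ℝ≥0 => x + (s : ℝ) := by fun_prop
    refine (this.tendsto' 0 x (by simp)).mono_left nhdsWithin_le_nhds
  · filter_upwards [self_mem_nhdsWithin] with s hs
    have : 0 < (s : ℝ) := hs
    simpa using this

theorem HasDeriv.norm_sub_le {A B : H →L[ℂ] H} (h : S.HasDeriv A B) (t : ℝ≥0) :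
    ‖S.map t A - A‖ ≤ ‖B‖ * t := by
  refine opNorm_le_of_inner (by positivity) fun x y => ?_
  set p := vectorPair x y with hp
  have key := norm_image_sub_le_of_norm_deriv_right_le_segment (a := 0) (b := (t : ℝ))
    (f := fun r : ℝ => traceFunctional p.1.1 p.1.2 (S.map r.toNNReal A))
    (f' := fun r : ℝ => traceFunctional p.1.1 p.1.2 (S.map r.toNNReal B))
    (C := ‖B‖ * ‖x‖ * ‖y‖) (S.continuous_traceFunctional_map p A).continuousOn ?_ ?_ t
    ⟨t.coe_nonneg, le_rfl⟩
  · simp only [Real.toNNReal_coe, Real.toNNReal_zero, S.map_zero, LinearMap.id_apply,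
      ← traceFunctional_sub] at key
    rw [hp, traceFunctional_vectorPair] at key
    linarith
  · intro r hr
    rw [← hasDerivWithinAt_Ioi_iff_Ici, hasDerivWithinAt_iff_tendsto_slope' (by simp)]
    have h1 := (tendsto_sigmaWeak.1 (tendsto_map (S := S) r.toNNReal h) p).comp (tendsto_sub_toNNReal r)
    refine h1.congr' ?_
    filter_upwards [self_mem_nhdsWithin] with z hz
    have hz' : r < z := hz
    have hr0 : 0 ≤ r := hr.1
    have e : r.toNNReal + (z - r).toNNReal = z.toNNReal := by
      rw [← Real.toNNReal_add hr0 (by linarith)]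
      congr 1; ring
    rw [Function.comp_apply, slope_eq, e, slope_def_module, Real.coe_toNNReal _ (by linarith),
      Complex.real_smul, Complex.ofReal_inv]
  · intro r _
    rw [hp, traceFunctional_vectorPair]
    calc ‖⟪x, S.map r.toNNReal B y⟫_ℂ‖ ≤ ‖x‖ * ‖S.map r.toNNReal B y‖ := norm_inner_le_norm _ _
      _ ≤ ‖x‖ * (‖S.map r.toNNReal B‖ * ‖y‖) := by
        gcongr; exact ContinuousLinearMap.le_opNorm _ _
      _ ≤ ‖x‖ * (‖B‖ * ‖y‖) := by gcongr; exact S.norm_map_le _ _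
      _ = _ := by ring

/-- Bounded families of operators have limits along ultrafilters. -/
theorem exists_ultrafilter_limit {ι : Type*} (l : Ultrafilter ι) (f : ι → (H →L[ℂ] H)) {C : ℝ}
    (hb : ∀ᶠ i in (l : Filter ι), ‖f i‖ ≤ C) :
    ∃ B : H →L[ℂ] H, Tendsto f l (@nhds _ (sigmaWeak H) B) := by
  have hbd : ∀ x y : H, ∀ᶠ i in (l : Filter ι), ‖⟪f i x, y⟫_ℂ‖ ≤ C * ‖x‖ * ‖y‖ := by
    intro x y
    filter_upwards [hb] with i hi
    calc ‖⟪f i x, y⟫_ℂ‖ ≤ ‖f i x‖ * ‖y‖ := norm_inner_le_norm _ _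
      _ ≤ (‖f i‖ * ‖x‖) * ‖y‖ := by gcongr; exact ContinuousLinearMap.le_opNorm _ _
      _ ≤ _ := by gcongr
  have hex : ∀ x y : H, ∃ z : ℂ, Tendsto (fun i => ⟪f i x, y⟫_ℂ) l (𝓝 z) := by
    intro x y
    obtain ⟨z, -, hz⟩ := (isCompact_closedBall (0 : ℂ) (C * ‖x‖ * ‖y‖)).ultrafilter_le_nhds
      (l.map fun i => ⟪f i x, y⟫_ℂ) (by
        rw [le_principal_iff, Ultrafilter.mem_coe, Ultrafilter.mem_map]
        refine mem_of_superset (hbd x y) fun i hi => ?_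
        simpa using hi)
    exact ⟨z, hz⟩
  choose b hb' using hex
  let bl : H →ₗ⋆[ℂ] H →ₗ[ℂ] ℂ := LinearMap.mk₂'ₛₗ (starRingEnd ℂ) (RingHom.id ℂ) b
    (fun x x' y => tendsto_nhds_unique (hb' _ _) (((hb' x y).add (hb' x' y)).congr fun i => by
      rw [_root_.map_add, inner_add_left]))
    (fun c x y => tendsto_nhds_unique (hb' _ _) (((hb' x y).const_mul (conj c)).congr fun i => by
      rw [_root_.map_smul, inner_smul_left]))
    (fun x y y' => tendsto_nhds_unique (hb' _ _) (((hb' x y).add (hb' x y')).congr fun i => by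
      rw [inner_add_right]))
    (fun c x y => tendsto_nhds_unique (hb' _ _) (((hb' x y).const_mul c).congr fun i => by
      rw [inner_smul_right]))
  have hle : ∀ x y, ‖bl x y‖ ≤ C * ‖x‖ * ‖y‖ := fun x y => by
    exact le_of_tendsto (hb' x y).norm (hbd x y)
  let B := InnerProductSpace.continuousLinearMapOfBilin (LinearMap.mkContinuous₂ bl C hle)
  have hB : ∀ x y, ⟪B x, y⟫_ℂ = b x y := fun x y => by
    rw [InnerProductSpace.continuousLinearMapOfBilin_apply]
    rfl
  refine ⟨B, tendsto_sigmaWeak_of_bounded hb fun x y => ?_⟩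
  have h1 := (Complex.continuous_conj.tendsto _).comp (hb' y x)
  rw [← inner_conj_symm, hB]
  refine h1.congr fun i => ?_
  rw [Function.comp_apply, inner_conj_symm]

theorem mem_domain_of_norm_sub_le {A : H →L[ℂ] H} {C : ℝ}
    (h : ∀ t : ℝ≥0, ‖S.map t A - A‖ ≤ C * t) : A ∈ S.generator.domain := by
  let l : Ultrafilter ℝ≥0 := Ultrafilter.of (𝓝[>] 0)
  have hl : (l : Filter ℝ≥0) ≤ 𝓝[>] 0 := Ultrafilter.of_le _
  have hbd : ∀ᶠ s : ℝ≥0 in 𝓝[>] 0, ‖((s : ℝ) : ℂ)⁻¹ • (S.map s A - A)‖ ≤ C := by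
    filter_upwards [self_mem_nhdsWithin] with s hs
    have hs' : 0 < (s : ℝ) := hs
    rw [norm_smul, norm_inv, Complex.norm_real, Real.norm_of_nonneg hs'.le, inv_mul_le_iff₀ hs',
      mul_comm]
    exact h s
  obtain ⟨B, hB⟩ := exists_ultrafilter_limit l _ (hl hbd)
  refine ⟨B, tendsto_sigmaWeak.2 fun p => ?_⟩
  set f : ℝ → ℂ := fun r => traceFunctional p.1.1 p.1.2 (S.map r.toNNReal A) with hf
  set g : ℝ → ℂ := fun r => traceFunctional p.1.1 p.1.2 (S.map r.toNNReal B) with hg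
  have hfc : Continuous f := S.continuous_traceFunctional_map p A
  have hgc : Continuous g := S.continuous_traceFunctional_map p B
  set k : ℝ → ℂ := fun r => ∫ s in (0 : ℝ)..r, g s with hk
  have hkd : ∀ r, HasDerivAt k (g r) r := fun r =>
    (hgc.integral_hasStrictDerivAt 0 r).hasDerivAt
  have hkc : Continuous k := continuous_iff_continuousAt.2 fun r => (hkd r).continuousAt
  -- difference quotients of `k` and `f` at `r`
  have hkq : ∀ r, Tendsto (fun s : ℝ≥0 => ((s : ℝ) : ℂ)⁻¹ * (k (r + s) - k r)) (𝓝[>] 0)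
      (𝓝 (g r)) := by
    intro r
    have h1 := (hasDerivWithinAt_iff_tendsto_slope' (s := Set.Ioi r) (by simp)).1
      (hkd r).hasDerivWithinAt
    refine (h1.comp (tendsto_add_coe r)).congr fun s => ?_
    rw [Function.comp_apply, slope_def_module, Complex.real_smul, Complex.ofReal_inv]
    congr 3
    ring
  have hfq : ∀ r, 0 ≤ r → Tendsto (fun s : ℝ≥0 => ((s : ℝ) : ℂ)⁻¹ * (f (r + s) - f r)) l
      (𝓝 (g r)) := by
    intro r hr
    refine (tendsto_sigmaWeak.1 (tendsto_map r.toNNReal hB) p).congr fun s => ?_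
    rw [slope_eq, hf]
    simp only
    rw [Real.toNNReal_add hr s.coe_nonneg, Real.toNNReal_coe]
  have heq : ∀ r, 0 ≤ r → f r = f 0 + k r := by
    intro r hr
    have h0 := image_le_of_liminf_slope_right_le_deriv_boundary (a := 0) (b := r)
      (f := fun r => ‖f r - f 0 - k r‖) (B := fun _ => 0) (B' := fun _ => 0)
      (by fun_prop) (by simp [hk]) continuousOn_const
      (fun x _ => hasDerivWithinAt_const _ _ _) (fun x hx c hc => by
        have h2 := ((hfq x hx.1).sub ((hkq x).mono_left hl)).norm
        rw [sub_self, norm_zero] at h2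
        refine (tendsto_add_coe x).frequently ?_
        have h3 : ∀ᶠ s : ℝ≥0 in (l : Filter ℝ≥0), 0 < s := hl self_mem_nhdsWithin
        refine Filter.Frequently.filter_mono ?_ hl
        refine Filter.Eventually.frequently ?_
        filter_upwards [h2.eventually (gt_mem_nhds hc), h3] with s hs hs0
        have hs' : 0 < (s : ℝ) := hs0
        refine lt_of_le_of_lt ?_ hs
        rw [slope_def_field, add_sub_cancel_left, ← mul_sub, norm_mul, norm_inv, Complex.norm_real,
          Real.norm_of_nonneg hs'.le, div_eq_inv_mul]
        gcongr
        refine (norm_sub_norm_le _ _).trans (le_of_eq ?_)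
        congr 1
        ring) ⟨hr, le_rfl⟩
    have h1 : f r - f 0 - k r = 0 := norm_le_zero_iff.1 h0
    linear_combination h1
  have h0 := hkq 0
  have hg0 : g 0 = traceFunctional p.1.1 p.1.2 B := by
    rw [hg]; simp [S.map_zero]
  rw [← hg0]
  refine h0.congr fun s => ?_
  have e1 : k 0 = 0 := by simp [hk]
  have e2 := heq s s.coe_nonneg
  have e3 := slope_eq (S := S) p A 0 s
  rw [S.map_zero] at e3
  simp only [LinearMap.id_apply, zero_add] at e3
  rw [e3, zero_add, e1, sub_zero]
  congr 1
  have e4 : f s = traceFunctional p.1.1 p.1.2 (S.map s A) := by rw [hf]; simp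
  have e5 : f 0 = traceFunctional p.1.1 p.1.2 A := by rw [hf]; simp [S.map_zero]
  rw [← e4, ← e5, e2]
  ring

theorem mem_domain_iff {A : H →L[ℂ] H} :
    A ∈ S.generator.domain ↔ ∃ C : ℝ, ∀ t : ℝ≥0, ‖S.map t A - A‖ ≤ C * t :=
  ⟨fun ⟨B, h⟩ => ⟨‖B‖, h.norm_sub_le⟩, fun ⟨_, h⟩ => mem_domain_of_norm_sub_le h⟩

end QuantumMarkovSemigroup

end Favard

/-! ### The domain algebra -/

section DomainAlgebra

variable {H : Type*} [NormedAddCommGroup H] [InnerProductSpace ℂ H] [CompleteSpace H]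

theorem norm_le_of_form_le {X : H →L[ℂ] H} {c : ℝ} (hc : 0 ≤ c) (h0 : ∀ u, 0 ≤ ⟪u, X u⟫_ℂ)
    (h1 : ∀ u, (⟪u, X u⟫_ℂ).re ≤ c * ‖u‖ ^ 2) : ‖X‖ ≤ c := by
  have hX : 0 ≤ X := by
    rw [ContinuousLinearMap.nonneg_iff_isPositive, ContinuousLinearMap.isPositive_iff_complex]
    intro u
    have h := Complex.nonneg_iff.1 (h0 u)
    rw [← inner_conj_symm u] at h
    simp only [Complex.conj_re, Complex.conj_im] at h
    refine ⟨Complex.ext rfl ?_, h.1⟩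
    simp only [Complex.ofReal_im]
    linarith [h.2]
  rw [CStarAlgebra.norm_le_iff_le_algebraMap X hc hX, ContinuousLinearMap.le_def,
    ContinuousLinearMap.isPositive_iff_complex]
  intro u
  have e : ⟪(algebraMap ℝ (H →L[ℂ] H) c - X) u, u⟫_ℂ =
      ((c * ‖u‖ ^ 2 : ℝ) : ℂ) - conj ⟪u, X u⟫_ℂ := by
    rw [sub_apply, inner_sub_left, inner_conj_symm, Algebra.algebraMap_eq_smul_one, smul_apply,
      one_apply_eq_self, RCLike.real_smul_eq_coe_smul (K := ℂ) c u, inner_smul_left,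
      inner_self_ofReal, Complex.ofReal_mul]
    congr 2
    exact Complex.conj_ofReal c
  have h := Complex.nonneg_iff.1 (h0 u)
  rw [e]
  have h2 := h1 u
  refine ⟨Complex.ext rfl ?_, ?_⟩
  · rw [Complex.ofReal_im, Complex.sub_im, Complex.ofReal_im, Complex.conj_im, ← h.2]
    simp
  · simp only [Complex.sub_re, Complex.ofReal_re, Complex.conj_re, RCLike.re_eq_complex_re]
    linarith

namespace QuantumMarkovSemigroup

variable {S : QuantumMarkovSemigroup H}

theorem star_mem_domain {A : H →L[ℂ] H} (h : A ∈ S.generator.domain) :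
    star A ∈ S.generator.domain := by
  obtain ⟨C, hC⟩ := mem_domain_iff.1 h
  refine mem_domain_iff.2 ⟨C, fun t => ?_⟩
  rw [(S.completelyPositive t).map_star, ← star_sub, norm_star]
  exact hC t

theorem one_mem_domain : (1 : H →L[ℂ] H) ∈ S.generator.domain := ⟨0, hasDeriv_one⟩

/-- The quadratic form `u ↦ ⟪u, (T_t(A* A) - T_t(A)* T_t(A)) u⟫` is of order `t`. -/
def BoundedDefect (S : QuantumMarkovSemigroup H) (A : H →L[ℂ] H) : Prop :=
  ∃ C : ℝ, ∀ (t : ℝ≥0) (u : H), (tensorForm (opForm (S.map t)) (defect (S.map t) A u)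
    (defect (S.map t) A u)).re ≤ C * t * ‖u‖ ^ 2

theorem norm_mul_sub_le {A B : H →L[ℂ] H} (hA : A ∈ S.generator.domain)
    (hB : B ∈ S.generator.domain) :
    ∃ C : ℝ, ∀ t : ℝ≥0, ‖S.map t A * S.map t B - A * B‖ ≤ C * t := by
  obtain ⟨CA, hA⟩ := mem_domain_iff.1 hA
  obtain ⟨CB, hB⟩ := mem_domain_iff.1 hB
  refine ⟨‖A‖ * CB + CA * ‖B‖, fun t => ?_⟩
  have e : S.map t A * S.map t B - A * B =
      S.map t A * (S.map t B - B) + (S.map t A - A) * B := by noncomm_ring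
  rw [e]
  calc _ ≤ ‖S.map t A * (S.map t B - B)‖ + ‖(S.map t A - A) * B‖ := norm_add_le _ _
    _ ≤ ‖S.map t A‖ * ‖S.map t B - B‖ + ‖S.map t A - A‖ * ‖B‖ :=
      add_le_add (norm_mul_le _ _) (norm_mul_le _ _)
    _ ≤ ‖A‖ * (CB * t) + CA * t * ‖B‖ := by
      gcongr
      · exact S.norm_map_le t A
      · exact hB t
      · exact hA t
    _ = _ := by ring

theorem boundedDefect_iff {A : H →L[ℂ] H} (hA : A ∈ S.generator.domain) :
    S.BoundedDefect A ↔ star A * A ∈ S.generator.domain := by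
  obtain ⟨C1, h1⟩ := norm_mul_sub_le (star_mem_domain hA) hA
  constructor
  · rintro ⟨C, hC⟩
    have hC' : ∀ (t : ℝ≥0) (u : H), (tensorForm (opForm (S.map t)) (defect (S.map t) A u)
        (defect (S.map t) A u)).re ≤ |C| * t * ‖u‖ ^ 2 := fun t u =>
      (hC t u).trans (by gcongr; exact le_abs_self C)
    refine mem_domain_iff.2 ⟨|C| + C1, fun t => ?_⟩
    have hcp := S.completelyPositive t
    have h2 : ‖S.map t (star A * A) - star (S.map t A) * S.map t A‖ ≤ |C| * t := by
      refine norm_le_of_form_le (by positivity) (fun u => ?_) (fun u => ?_)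
      · rw [← hcp.form_defect (S.map_one t)]
        exact hcp.tensorForm_nonneg _
      · rw [← hcp.form_defect (S.map_one t)]
        exact hC' t u
    have h3 := h1 t
    rw [hcp.map_star] at h3
    calc _ = ‖(S.map t (star A * A) - star (S.map t A) * S.map t A) +
        (star (S.map t A) * S.map t A - star A * A)‖ := by congr 1; abel
      _ ≤ _ := norm_add_le _ _
      _ ≤ |C| * t + C1 * t := add_le_add h2 h3
      _ = _ := by ring
  · intro h
    obtain ⟨C, hC⟩ := mem_domain_iff.1 h
    refine ⟨C + C1, fun t u => ?_⟩
    have hcp := S.completelyPositive t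
    rw [hcp.form_defect (S.map_one t)]
    have h3 := h1 t
    rw [hcp.map_star] at h3
    have h2 : ‖S.map t (star A * A) - star (S.map t A) * S.map t A‖ ≤ (C + C1) * t := by
      calc _ = ‖(S.map t (star A * A) - star A * A) -
          (star (S.map t A) * S.map t A - star A * A)‖ := by congr 1; abel
        _ ≤ _ := norm_sub_le _ _
        _ ≤ C * t + C1 * t := add_le_add (hC t) h3
        _ = _ := by ring
    refine (Complex.re_le_norm _).trans ((norm_inner_le_norm _ _).trans ?_)
    calc _ ≤ ‖u‖ * (‖S.map t (star A * A) - star (S.map t A) * S.map t A‖ * ‖u‖) := by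
          gcongr; exact ContinuousLinearMap.le_opNorm _ _
      _ ≤ ‖u‖ * (((C + C1) * t) * ‖u‖) := by gcongr
      _ = _ := by ring

theorem BoundedDefect.add {A B : H →L[ℂ] H} (hA : S.BoundedDefect A) (hB : S.BoundedDefect B) :
    S.BoundedDefect (A + B) := by
  obtain ⟨CA, hA⟩ := hA
  obtain ⟨CB, hB⟩ := hB
  refine ⟨2 * CA + 2 * CB, fun t u => ?_⟩
  rw [defect_add]
  refine (form_add_le _ (S.completelyPositive t).tensorForm_nonneg _ _).trans ?_
  linarith [hA t u, hB t u]

theorem BoundedDefect.mul {A B : H →L[ℂ] H} (hA : A ∈ S.generator.domain)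
    (hB : B ∈ S.generator.domain) (hAB : A * B ∈ S.generator.domain) (dA : S.BoundedDefect A)
    (dB : S.BoundedDefect B) : S.BoundedDefect (A * B) := by
  obtain ⟨CA, dA⟩ := dA
  obtain ⟨CB, dB⟩ := dB
  obtain ⟨C1, h1⟩ := norm_mul_sub_le hA hB
  obtain ⟨C2, h2⟩ := mem_domain_iff.1 hAB
  refine ⟨2 * (‖A‖ ^ 2 * CB) + 2 * (2 * (|CA| * ‖B‖ ^ 2) +
    2 * ((C1 + C2) * (2 * ‖A‖ * ‖B‖))), fun t u => ?_⟩
  have hcp := S.completelyPositive t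
  set Φ := S.map t with hΦ
  have e1 := hcp.lmul_le A (defect Φ B u)
  have e2 := dB t u
  have e3 : (tensorForm (opForm Φ) (defect Φ A (Φ B u)) (defect Φ A (Φ B u))).re ≤
      |CA| * t * (‖B‖ ^ 2 * ‖u‖ ^ 2) := by
    refine (dA t (Φ B u)).trans ?_
    have : ‖Φ B u‖ ≤ ‖B‖ * ‖u‖ := (ContinuousLinearMap.le_opNorm _ _).trans (by
      gcongr; exact S.norm_map_le t B)
    rw [← mul_pow]
    gcongr
    exact le_abs_self _
  set Z := Φ A * Φ B - Φ (A * B) with hZ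
  have hZ1 : ‖Z‖ ≤ (C1 + C2) * t := by
    calc _ = ‖(Φ A * Φ B - A * B) - (Φ (A * B) - A * B)‖ := by congr 1; rw [hZ]; abel
      _ ≤ _ := norm_sub_le _ _
      _ ≤ C1 * t + C2 * t := add_le_add (h1 t) (h2 t)
      _ = _ := by ring
  have hZ2 : ‖Z‖ ≤ 2 * ‖A‖ * ‖B‖ := by
    have a1 : ‖Φ A * Φ B‖ ≤ ‖A‖ * ‖B‖ := (norm_mul_le _ _).trans (by
      gcongr <;> exact S.norm_map_le t _)
    have a2 : ‖Φ (A * B)‖ ≤ ‖A‖ * ‖B‖ := (S.norm_map_le t _).trans (norm_mul_le _ _)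
    calc _ ≤ _ := norm_sub_le _ _
      _ ≤ _ := by linarith
  have e4 : (tensorForm (opForm Φ) (1 ⊗ₜ (Z u)) (1 ⊗ₜ (Z u))).re ≤
      ((C1 + C2) * t * (2 * ‖A‖ * ‖B‖)) * ‖u‖ ^ 2 := by
    rw [form_one (S.map_one t), Complex.ofReal_re]
    have a1 : ‖Z u‖ ≤ ‖Z‖ * ‖u‖ := ContinuousLinearMap.le_opNorm _ _
    calc ‖Z u‖ ^ 2 ≤ (‖Z‖ * ‖u‖) ^ 2 := by gcongr
      _ = (‖Z‖ * ‖Z‖) * ‖u‖ ^ 2 := by ring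
      _ ≤ _ := by gcongr; exact (norm_nonneg _).trans hZ1
  rw [defect_mul]
  have f1 := form_add_le _ hcp.tensorForm_nonneg (lmul A (defect Φ B u))
    (defect Φ A (Φ B u) + 1 ⊗ₜ (Z u))
  have f2 := form_add_le _ hcp.tensorForm_nonneg (defect Φ A (Φ B u)) (1 ⊗ₜ (Z u))
  have e5 : ‖A‖ ^ 2 * (tensorForm (opForm Φ) (defect Φ B u) (defect Φ B u)).re ≤
      ‖A‖ ^ 2 * (CB * t * ‖u‖ ^ 2) := by gcongr
  refine f1.trans ?_
  linarith

/-- If `A`, `B`, `A* A` and `B* B` lie in the domain, so does `A* B` (by polarization). -/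
theorem star_mul_mem_domain {A B : H →L[ℂ] H} (hA : A ∈ S.generator.domain)
    (hB : B ∈ S.generator.domain) (dA : S.BoundedDefect A) (dB : S.BoundedDefect B) :
    star A * B ∈ S.generator.domain := by
  have key : ∀ c : ℂ, c * conj c = 1 →
      conj c • (star B * A) + c • (star A * B) ∈ S.generator.domain := by
    intro c hc
    have hcB : c • B ∈ S.generator.domain := S.generator.domain.smul_mem c hB
    have hBB := (boundedDefect_iff hB).1 dB
    have e : star (c • B) * (c • B) = star B * B := by
      rw [star_smul, smul_mul_smul_comm, mul_comm, Complex.star_def, hc, one_smul]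
    have dcB : S.BoundedDefect (c • B) := (boundedDefect_iff hcB).2 (by rwa [e])
    have h := (boundedDefect_iff (S.generator.domain.add_mem hA hcB)).1 (dA.add dcB)
    have h2 := S.generator.domain.sub_mem (S.generator.domain.sub_mem h
      ((boundedDefect_iff hA).1 dA)) hBB
    convert h2 using 1
    rw [star_add, add_mul, mul_add, mul_add, e, star_smul, smul_mul_assoc, mul_smul_comm,
      Complex.star_def]
    abel
  have h1 := key 1 (by simp)
  have h2 := key Complex.I (by simp)
  have h3 := S.generator.domain.smul_mem (-Complex.I) h2
  have h4 := S.generator.domain.smul_mem (2⁻¹ : ℂ) (S.generator.domain.add_mem h1 h3)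
  convert h4 using 1
  simp only [smul_add, smul_smul, Complex.conj_I, one_smul]
  match_scalars <;> (ring_nf; simp; try norm_num)

variable (S)

/-- The domain algebra of the generator: the largest `*`-subalgebra of `B(H)` contained in `D(L)`.
It consists of all `A ∈ D(L)` with `A* A ∈ D(L)` and `A A* ∈ D(L)`. -/
def domainAlgebra : StarSubalgebra ℂ (H →L[ℂ] H) where
  carrier := {A | A ∈ S.generator.domain ∧ star A * A ∈ S.generator.domain ∧
    A * star A ∈ S.generator.domain}
  star_mem' := by
    rintro A ⟨h, h1, h2⟩
    exact ⟨star_mem_domain h, by rwa [star_star], by rwa [star_star]⟩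
  add_mem' := by
    rintro A B ⟨hA, hA1, hA2⟩ ⟨hB, hB1, hB2⟩
    have hAB := S.generator.domain.add_mem hA hB
    have d1 := ((boundedDefect_iff hA).2 hA1).add ((boundedDefect_iff hB).2 hB1)
    have d2 := ((boundedDefect_iff (star_mem_domain hA)).2 (by rwa [star_star])).add
      ((boundedDefect_iff (star_mem_domain hB)).2 (by rwa [star_star]))
    rw [← star_add] at d2
    have h2 := (boundedDefect_iff (star_mem_domain hAB)).1 d2
    rw [star_star] at h2
    exact ⟨hAB, (boundedDefect_iff hAB).1 d1, h2⟩
  mul_mem' := by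
    rintro A B ⟨hA, hA1, hA2⟩ ⟨hB, hB1, hB2⟩
    have dA := (boundedDefect_iff hA).2 hA1
    have dB := (boundedDefect_iff hB).2 hB1
    have dA' := (boundedDefect_iff (star_mem_domain hA)).2 (by rwa [star_star])
    have dB' := (boundedDefect_iff (star_mem_domain hB)).2 (by rwa [star_star])
    have hAB : A * B ∈ S.generator.domain := by
      have h := star_mul_mem_domain (star_mem_domain hA) hB dA' dB
      rwa [star_star] at h
    have hAB' := star_mem_domain hAB
    have d1 := dA.mul hA hB hAB dB
    rw [star_mul] at hAB'
    have d2 := dB'.mul (star_mem_domain hB) (star_mem_domain hA) hAB' dA'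
    have h2 := (boundedDefect_iff hAB').1 d2
    rw [← star_mul, star_star] at h2
    exact ⟨hAB, (boundedDefect_iff hAB).1 d1, h2⟩
  algebraMap_mem' := by
    intro c
    have h : ∀ d : ℂ, algebraMap ℂ (H →L[ℂ] H) d ∈ S.generator.domain := fun d => by
      rw [Algebra.algebraMap_eq_smul_one]
      exact S.generator.domain.smul_mem d one_mem_domain
    refine ⟨h c, ?_, ?_⟩ <;>
    · rw [← algebraMap_star_comm, ← map_mul]
      exact h _

theorem mem_domainAlgebra {A : H →L[ℂ] H} : A ∈ S.domainAlgebra ↔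
    A ∈ S.generator.domain ∧ star A * A ∈ S.generator.domain ∧
      A * star A ∈ S.generator.domain := Iff.rfl

theorem domainAlgebra_isGreatest :
    IsGreatest {B : StarSubalgebra ℂ (H →L[ℂ] H) | ∀ A ∈ B, A ∈ S.generator.domain}
      S.domainAlgebra :=
  ⟨fun _ hA => hA.1, fun _ hB _ hA =>
    ⟨hB _ hA, hB _ (mul_mem (star_mem hA) hA), hB _ (mul_mem hA (star_mem hA))⟩⟩

end QuantumMarkovSemigroup

end DomainAlgebra

/-! ### The dilation of a completely positive map into sesquilinear forms -/

section Dilation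

variable {H : Type*} [NormedAddCommGroup H] [InnerProductSpace ℂ H] [CompleteSpace H]

/-- Sesquilinear forms on `U × U`, conjugate linear in the first variable. -/
abbrev SesqForm (U : Submodule ℂ H) : Type _ := U →ₗ⋆[ℂ] U →ₗ[ℂ] ℂ

/-- `φ` is `U`-completely positive: `∑ φ(A_ij)(u_i, u_j) ≥ 0` for every positive matrix
`(A_ij)` with entries in `𝒜` and all `u_1, …, u_k` in `U`. -/
def IsUCompletelyPositive {𝒜 : StarSubalgebra ℂ (H →L[ℂ] H)} {U : Submodule ℂ H}
    (φ : 𝒜 →ₗ[ℂ] SesqForm U) : Prop :=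
  ∀ (k : ℕ) (A : Matrix (Fin k) (Fin k) 𝒜),
    IsPositiveMatrix (A.map fun a => (a : H →L[ℂ] H)) →
      ∀ u : Fin k → U, 0 ≤ ∑ i, ∑ j, φ (A i j) (u i) (u j)

variable {𝒜 : StarSubalgebra ℂ (H →L[ℂ] H)} {U : Submodule ℂ H} {φ : 𝒜 →ₗ[ℂ] SesqForm U}

theorem IsUCompletelyPositive.tensorForm_nonneg (hφ : IsUCompletelyPositive φ) (x : 𝒜 ⊗[ℂ] U) :
    0 ≤ tensorForm φ x x :=
  QMS.tensorForm_nonneg φ (fun n A u =>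
    hφ n (Matrix.of fun i j => star (A i) * A j)
      (isPositiveMatrix_gram fun i => (A i : H →L[ℂ] H)) u) x

/-- The algebraic tensor product `𝒜 ⊗ U`, regarded as a space with the semi-inner product
`(A ⊗ u, B ⊗ v) = φ(A* B)(u, v)`. -/
def PreDilation (_hφ : IsUCompletelyPositive φ) : Type _ := 𝒜 ⊗[ℂ] U

variable (hφ : IsUCompletelyPositive φ)

noncomputable instance : AddCommGroup (PreDilation hφ) :=
  inferInstanceAs (AddCommGroup (𝒜 ⊗[ℂ] U))

noncomputable instance : Module ℂ (PreDilation hφ) := inferInstanceAs (Module ℂ (𝒜 ⊗[ℂ] U))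

/-- The identity map from `𝒜 ⊗ U` to the semi-inner product space. -/
noncomputable def toPreDilation : 𝒜 ⊗[ℂ] U ≃ₗ[ℂ] PreDilation hφ := LinearEquiv.refl ℂ (𝒜 ⊗[ℂ] U)

/-- The semi-inner product `(A ⊗ u, B ⊗ v) = φ(A* B)(u, v)`. -/
noncomputable abbrev preDilationCore : PreInnerProductSpace.Core ℂ (PreDilation hφ) where
  inner x y := tensorForm φ ((toPreDilation hφ).symm x) ((toPreDilation hφ).symm y)
  conj_inner_symm x y := conj_symm_of_nonneg _ hφ.tensorForm_nonneg _ _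
  re_inner_nonneg x := (Complex.nonneg_iff.1 (hφ.tensorForm_nonneg _)).1
  add_left x y z := by simp
  smul_left x y r := by simp

noncomputable instance : SeminormedAddCommGroup (PreDilation hφ) :=
  InnerProductSpace.Core.toSeminormedAddCommGroup (c := preDilationCore hφ)

noncomputable instance : InnerProductSpace ℂ (PreDilation hφ) :=
  InnerProductSpace.ofCore (preDilationCore hφ)

theorem preDilation_inner (A B : 𝒜) (u v : U) :
    ⟪toPreDilation hφ (A ⊗ₜ u), toPreDilation hφ (B ⊗ₜ v)⟫_ℂ = φ (star A * B) u v :=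
  tensorForm_tmul φ A B u v

/-- The dilation space `𝒦`: the completion of `(𝒜 ⊗ U) / N`, where `N` is the subspace of null
vectors of the semi-inner product. -/
abbrev DilationSpace : Type _ := UniformSpace.Completion (SeparationQuotient (PreDilation hφ))

/-- The dilation map `V : U → 𝒦`, `V u = 1 ⊗ u + N`. -/
noncomputable def dilationMap : U →ₗ[ℂ] DilationSpace hφ :=
  (UniformSpace.Completion.toComplₗᵢ (𝕜 := ℂ)
      (E := SeparationQuotient (PreDilation hφ))).toLinearMap ∘ₗ
    (SeparationQuotient.mkCLM ℂ (PreDilation hφ)).toLinearMap ∘ₗ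
      (toPreDilation hφ).toLinearMap ∘ₗ TensorProduct.mk ℂ 𝒜 U 1

theorem dilationMap_apply (u : U) : dilationMap hφ u =
    ((SeparationQuotient.mk (toPreDilation hφ (1 ⊗ₜ u)) :
      SeparationQuotient (PreDilation hφ)) : DilationSpace hφ) := rfl

end Dilation

/-! ### The subspace `U` and the operator `G` -/

section Operators

variable {H : Type*} [NormedAddCommGroup H] [InnerProductSpace ℂ H] [CompleteSpace H]

/-- The rank one operator `|x⟩⟨y| : v ↦ ⟪y, v⟫ x`. -/
noncomputable def ketBra (x y : H) : H →L[ℂ] H := InnerProductSpace.rankOne ℂ x y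

theorem ketBra_apply (x y v : H) : ketBra x y v = ⟪y, v⟫_ℂ • x := rfl

/-- `h` is an associate vector of the positive finite rank operator `T`: for some spectral
decomposition `T = ∑ t'_s |k'_s⟩⟨k'_s|` with `k'_1, …, k'_m` orthonormal, `m ≥ 1` and `t'_s > 0`,
`h = ∑ ‖k_s‖⁻² k_s` where `k_s = √t k'_s` and `t = ∑ t'_s`. -/
def IsAssociateVector (T : H →L[ℂ] H) (h : H) : Prop :=
  ∃ (m : ℕ) (k' : Fin m → H) (t' : Fin m → ℝ), 0 < m ∧ Orthonormal ℂ k' ∧ (∀ s, 0 < t' s) ∧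
    T = ∑ s, (t' s : ℂ) • ketBra (k' s) (k' s) ∧
    ∃ k : Fin m → H, (∀ s, k s = ((√(∑ r, t' r) : ℝ) : ℂ) • k' s) ∧
      h = ∑ s, ((‖k s‖ ^ 2 : ℝ) : ℂ)⁻¹ • k s

namespace QuantumMarkovSemigroup

variable (S : QuantumMarkovSemigroup H)

/-- The subspace `{x | |x⟩⟨e| ∈ 𝒜}`, where `𝒜` is the domain algebra. -/
def ketSpace (e : H) : Submodule ℂ H where
  carrier := {x | ketBra x e ∈ S.domainAlgebra}
  add_mem' {x y} hx hy := by
    have : ketBra (x + y) e = ketBra x e + ketBra y e := by ext; simp [ketBra_apply]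
    rw [Set.mem_ofPred_eq, this]
    exact add_mem hx hy
  zero_mem' := by
    have : ketBra (0 : H) e = 0 := by ext; simp [ketBra_apply]
    rw [Set.mem_ofPred_eq, this]
    exact zero_mem _
  smul_mem' c x hx := by
    have : ketBra (c • x) e = c • ketBra x e := by ext; simp [ketBra_apply, smul_comm c]
    rw [Set.mem_ofPred_eq, this]
    exact SMulMemClass.smul_mem c hx

variable {S}

theorem domainAlgebra_le {A : H →L[ℂ] H} (hA : A ∈ S.domainAlgebra) : A ∈ S.generator.domain :=
  hA.1

/-- The domain algebra leaves `{x | |x⟩⟨e| ∈ 𝒜}` invariant. -/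
theorem apply_mem_ketSpace {e v : H} {A : H →L[ℂ] H} (hA : A ∈ S.domainAlgebra)
    (hv : v ∈ S.ketSpace e) : A v ∈ S.ketSpace e := by
  have : ketBra (A v) e = A * ketBra v e := by ext; simp [ketBra_apply]
  change ketBra (A v) e ∈ S.domainAlgebra
  rw [this]
  exact mul_mem hA hv

variable (S)

/-- `|x⟩⟨e|` as an element of the domain of the generator, for `x` with `|x⟩⟨e| ∈ 𝒜`. -/
noncomputable def ketDomain (e : H) (x : S.ketSpace e) : S.generator.domain :=
  ⟨ketBra (x : H) e, domainAlgebra_le x.2⟩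

/-- The operator `G x = L(|x⟩⟨Th|) h - ½ ⟪h, L(T) h⟫ x` on `U = {x | |x⟩⟨Th| ∈ 𝒜}`. -/
noncomputable def G (T : S.generator.domain) (h : H) :
    S.ketSpace ((T : H →L[ℂ] H) h) →ₗ[ℂ] H where
  toFun x := S.generator (S.ketDomain _ x) h - ((1 / 2 : ℂ) * ⟪h, S.generator T h⟫_ℂ) • (x : H)
  map_add' x y := by
    have : S.ketDomain _ (x + y) = S.ketDomain _ x + S.ketDomain _ y := by
      ext; simp [ketDomain, ketBra_apply]
    rw [this, LinearPMap.map_add, add_apply, Submodule.coe_add, smul_add]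
    abel
  map_smul' c x := by
    have : S.ketDomain _ (c • x) = c • S.ketDomain _ x := by
      ext; simp [ketDomain, ketBra_apply, smul_comm c]
    rw [this, LinearPMap.map_smul, smul_apply, Submodule.coe_smul, RingHom.id_apply, smul_sub,
      smul_comm c]

/-- `⟪u, L(A) v⟫ = φ(A)(u, v) + ⟪u, G A v⟫ + ⟪G A* u, v⟫` for all `A ∈ 𝒜` and `u, v ∈ U`. -/
def GeneratorForm (T : S.generator.domain) (h : H)
    (φ : S.domainAlgebra →ₗ[ℂ] SesqForm (S.ketSpace ((T : H →L[ℂ] H) h))) : Prop :=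
  ∀ (A : S.domainAlgebra) (u v : S.ketSpace ((T : H →L[ℂ] H) h)),
    ⟪(u : H), S.generator ⟨A, domainAlgebra_le A.2⟩ (v : H)⟫_ℂ =
      φ A u v
      + ⟪(u : H), S.G T h ⟨(A : H →L[ℂ] H) v, apply_mem_ketSpace A.2 v.2⟩⟫_ℂ
      + ⟪S.G T h ⟨(star (A : H →L[ℂ] H)) u, apply_mem_ketSpace (star_mem A.2) u.2⟩, (v : H)⟫_ℂ

end QuantumMarkovSemigroup

end Operators

end QMS

namespace QMS

section Dilation

variable {H : Type*} [NormedAddCommGroup H] [InnerProductSpace ℂ H] [CompleteSpace H]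
  {𝒜 : StarSubalgebra ℂ (H →L[ℂ] H)} {U : Submodule ℂ H} {φ : 𝒜 →ₗ[ℂ] SesqForm U}

theorem norm_dilationMap_sq (hφ : IsUCompletelyPositive φ) (u : U) :
    ((‖dilationMap hφ u‖ ^ 2 : ℝ) : ℂ) = φ 1 u u := by
  rw [← inner_self_ofReal, dilationMap_apply, UniformSpace.Completion.inner_coe,
    SeparationQuotient.inner_mk_mk, preDilation_inner, star_one, one_mul]

end Dilation

namespace QuantumMarkovSemigroup

theorem generator_one {H : Type*} [NormedAddCommGroup H] [InnerProductSpace ℂ H]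
    (S : QuantumMarkovSemigroup H) : S.generator ⟨1, S.mem_domain.2 ⟨0, hasDeriv_one⟩⟩ = 0 :=
  (S.generator_hasDeriv _).unique hasDeriv_one

variable {H : Type*} [NormedAddCommGroup H] [InnerProductSpace ℂ H] [CompleteSpace H]
  {S : QuantumMarkovSemigroup H} {T : S.generator.domain} {h : H}

theorem norm_G_le (x : S.ketSpace ((T : H →L[ℂ] H) h)) :
    ‖S.G T h x‖ ≤
      ‖S.generator (S.ketDomain _ x) h‖ + ‖(1 / 2 : ℂ) * ⟪h, S.generator T h⟫_ℂ‖ * ‖x‖ :=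
  (norm_sub_le _ _).trans_eq <| by rw [norm_smul, Submodule.coe_norm]

namespace GeneratorForm

variable {φ : S.domainAlgebra →ₗ[ℂ] SesqForm (S.ketSpace ((T : H →L[ℂ] H) h))}

theorem apply_one (hform : S.GeneratorForm T h φ) (u v : S.ketSpace ((T : H →L[ℂ] H) h)) :
    φ 1 u v = -(⟪(u : H), S.G T h v⟫_ℂ + ⟪S.G T h u, (v : H)⟫_ℂ) := by
  have form_at_one := hform 1 u v
  simp only [OneMemClass.coe_one, generator_one, star_one, one_apply_eq_self, zero_apply,
    inner_zero_right, Subtype.coe_eta] at form_at_one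
  linear_combination -form_at_one

theorem norm_dilationMap_sq (hform : S.GeneratorForm T h φ) (hφ : IsUCompletelyPositive φ)
    (x : S.ketSpace ((T : H →L[ℂ] H) h)) :
    ‖dilationMap hφ x‖ ^ 2 = -2 * (⟪(x : H), S.G T h x⟫_ℂ).re := by
  have key := (QMS.norm_dilationMap_sq hφ x).trans (hform.apply_one x x)
  rw [← inner_conj_symm (S.G T h x), Complex.add_conj] at key
  have key_real : ‖dilationMap hφ x‖ ^ 2 = -(2 * (⟪(x : H), S.G T h x⟫_ℂ).re) := by
    exact_mod_cast key
  rw [key_real, neg_mul]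

theorem norm_dilationMap_le (hform : S.GeneratorForm T h φ) (hφ : IsUCompletelyPositive φ)
    {C : ℝ} (hG : ∀ x, ‖S.G T h x‖ ≤ C * ‖x‖) (x : S.ketSpace ((T : H →L[ℂ] H) h)) :
    ‖dilationMap hφ x‖ ≤ √(2 * C) * ‖x‖ := by
  have sq_le : ‖dilationMap hφ x‖ ^ 2 ≤ 2 * C * ‖x‖ ^ 2 := calc
    ‖dilationMap hφ x‖ ^ 2 = 2 * -(⟪(x : H), S.G T h x⟫_ℂ).re := by
      rw [hform.norm_dilationMap_sq hφ]; ring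
    _ ≤ 2 * ‖⟪(x : H), S.G T h x⟫_ℂ‖ := by
      gcongr; exact (neg_le_abs _).trans (Complex.abs_re_le_norm _)
    _ ≤ 2 * (‖x‖ * (C * ‖x‖)) := by
      gcongr; exact (norm_inner_le_norm _ _).trans (by gcongr; exacts [le_rfl, hG x])
    _ = 2 * C * ‖x‖ ^ 2 := by ring
  calc ‖dilationMap hφ x‖ ≤ √(2 * C * ‖x‖ ^ 2) := Real.le_sqrt_of_sq_le sq_le
    _ = √(2 * C) * ‖x‖ := by
      rw [Real.sqrt_mul' _ (sq_nonneg _), Real.sqrt_sq (norm_nonneg _)]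

end GeneratorForm

end QuantumMarkovSemigroup

end QMS

/-- Since `L(1) = 0`, the generator form at `A = 1` reads `‖V x‖² = -2 Re ⟪x, G x⟫`, so a bound on
`G` gives one on `V`. -/
theorem proposition5p1_general {H : Type*} [NormedAddCommGroup H] [InnerProductSpace ℂ H]
    [CompleteSpace H] (S : QMS.QuantumMarkovSemigroup H) (T : S.generator.domain) (h : H)
    (hL : ∃ C : ℝ, ∀ x : S.ketSpace ((T : H →L[ℂ] H) h),
      ‖S.generator (S.ketDomain _ x) h‖ ≤ C * ‖x‖) :
    (∃ C : ℝ, ∀ x : S.ketSpace ((T : H →L[ℂ] H) h), ‖S.G T h x‖ ≤ C * ‖x‖) ∧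
    ∀ (φ : S.domainAlgebra →ₗ[ℂ] QMS.SesqForm (S.ketSpace ((T : H →L[ℂ] H) h)))
      (hφ : QMS.IsUCompletelyPositive φ), S.GeneratorForm T h φ →
      ∃ C : ℝ, ∀ x : S.ketSpace ((T : H →L[ℂ] H) h), ‖QMS.dilationMap hφ x‖ ≤ C * ‖x‖ := by
  obtain ⟨C, hC⟩ := hL
  have G_bounded (x : S.ketSpace ((T : H →L[ℂ] H) h)) :
      ‖S.G T h x‖ ≤ (C + ‖(1 / 2 : ℂ) * ⟪h, S.generator T h⟫_ℂ‖) * ‖x‖ := by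
    rw [add_mul]
    exact QMS.QuantumMarkovSemigroup.norm_G_le x |>.trans (by gcongr; exact hC x)
  exact ⟨⟨_, G_bounded⟩, fun φ hφ hform => ⟨_, hform.norm_dilationMap_le hφ G_bounded⟩⟩

theorem proposition5p1 {H : Type*} [NormedAddCommGroup H] [InnerProductSpace ℂ H] [CompleteSpace H]
    (S : QMS.QuantumMarkovSemigroup H)
    (T : S.generator.domain)
    (hTpos : (T : H →L[ℂ] H).IsPositive)
    (hTfin : FiniteDimensional ℂ (LinearMap.range (T : H →L[ℂ] H).toLinearMap))
    (h : H) (hh : QMS.IsAssociateVector (T : H →L[ℂ] H) h)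
    (hTh : QMS.ketBra ((T : H →L[ℂ] H) h) ((T : H →L[ℂ] H) h) ∈ S.generator.domain)
    (hL : ∃ C : ℝ, 0 < C ∧ ∀ x : S.ketSpace ((T : H →L[ℂ] H) h),
      ‖S.generator (S.ketDomain _ x) h‖ ≤ C * ‖x‖) :
    (∃ C : ℝ, ∀ x : S.ketSpace ((T : H →L[ℂ] H) h), ‖S.G T h x‖ ≤ C * ‖x‖) ∧
    ∀ (φ : S.domainAlgebra →ₗ[ℂ] QMS.SesqForm (S.ketSpace ((T : H →L[ℂ] H) h)))
      (hφ : QMS.IsUCompletelyPositive φ), S.GeneratorForm T h φ →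
      ∃ C : ℝ, ∀ x : S.ketSpace ((T : H →L[ℂ] H) h), ‖QMS.dilationMap hφ x‖ ≤ C * ‖x‖ :=
  proposition5p1_general S T h (hL.imp fun _ => And.right)
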